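/- Write $[m]_q=1+q+\cdots+q^{m-1}$ and $(x;q)_m=\prod_{i=0}^{m-1}(1-xq^i)$. Carlitz's $q$-Eulerian polynomials $A_m(t,q)$ are defined by $$\sum_{k\ge 0}[k+1]_q^m\,t^k=\frac{A_m(t,q)}{(t;q)_{m+1}},$$ and the polynomials $a_{m,k}(q)$ $(1\le k\le\lfloor (m+1)/2\rfloor)$ are the coefficients of the expansion $$A_m(t,q)=\sum_{k=1}^{\lfloor (m+1)/2\rfloor}a_{m,k}(q)\,t^{k-1}(-tq^k;q)_{m+1-2k}.$$ A doubloon of order $2n+1$ is a $2\times(n+1)$ matrix $\delta=\binom{a_0\,\cdots\,a_n}{b_0\,\cdots\,b_n}$ whose entries are the integers $0,1,\dots,2n+1$, each occurring exactly once. It is normalized if $a_0=0$, and interlaced if for every $k=1,\dots,n$ the sequence $(a_{k-1},a_k,b_{k-1},b_k)$ or one of its three cyclic rearrangements is monotonic increasing or decreasing. Put $$\mathrm{cmaj}'\,\delta=\mathrm{maj}(a_0\cdots a_nb_n\cdots b_0)-(n+1)\,\mathrm{des}(a_0\cdots a_nb_n\cdots b_0)+n^2,$$ where $\mathrm{des}\,w$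 is the number of positions $i$ with $w_i>w_{i+1}$, and $\mathrm{maj}\,w$ is the sum of these positions (the first letter having position $1$). Proposition. For every integer $n\ge 0$, the expansion above exists with coefficients in $\mathbb{Z}[q]$ for $m=2n+1$, and its central coefficient $a_{2n+1,n+1}(q)$ is the generating function for the set of normalized interlaced doubloons of order $2n+1$ by the statistic $\mathrm{cmaj}'$: $$a_{2n+1,n+1}(q)=\sum_{\delta}q^{\mathrm{cmaj}'\,\delta},$$ where $\delta$ runs over the interlaced doubloons of order $2n+1$ with $a_0=0$. -/

import Mathlib

open Polynomial
open scoped LaurentPolynomial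

/-- The `q`-integer `[m]_q = 1 + q + ⋯ + q^(m-1)`, where `q` is the variable of `ℤ[X]`. -/
noncomputable def qInt (m : ℕ) : ℤ[X] := ∑ i ∈ Finset.range m, (X : ℤ[X]) ^ i

/-- The shifted factorial `(x; q)_m = (1 - x) (1 - x q) ⋯ (1 - x q^(m-1))` in a commutative
ring. -/
def qShiftedFactorial {R : Type*} [CommRing R] (x q : R) (m : ℕ) : R :=
  ∏ i ∈ Finset.range m, (1 - x * q ^ i)

/-- The variable `q`, as an element of the ring `ℤ[q]⟦t⟧` of formal power series in `t`. -/
noncomputable def qSeries : PowerSeries ℤ[X] := PowerSeries.C (X : ℤ[X])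

/-- Carlitz's `q`-Eulerian polynomial `A_m(t, q)`, as an element of `ℤ[q]⟦t⟧`, defined by
`∑_{k ≥ 0} [k+1]_q^m t^k = A_m(t, q) / (t; q)_{m+1}`. -/
noncomputable def carlitzEulerian (m : ℕ) : PowerSeries ℤ[X] :=
  PowerSeries.mk (fun k => qInt (k + 1) ^ m) *
    qShiftedFactorial (PowerSeries.X : PowerSeries ℤ[X]) qSeries (m + 1)

/-- The polynomials `a k`, for `1 ≤ k ≤ ⌊(m+1)/2⌋`, are the coefficients `a_{m,k}(q)` of the
expansion `A_m(t, q) = ∑_k a_{m,k}(q) t^(k-1) (-t q^k; q)_{m+1-2k}`.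
(Here `k ≥ 1` and `2 k ≤ m + 1`, so no subtraction is truncated.) -/
def IsEulerianExpansion (m : ℕ) (a : ℕ → ℤ[X]) : Prop :=
  carlitzEulerian m =
    ∑ k ∈ Finset.Icc 1 ((m + 1) / 2),
      PowerSeries.C (a k) * PowerSeries.X ^ (k - 1) *
        qShiftedFactorial (-(PowerSeries.X * qSeries ^ k)) qSeries (m + 1 - 2 * k)

/-- The set of descents of a word `w = w_1 w_2 ⋯ w_m`: the positions `i` with `1 ≤ i < m` and
`w_i > w_{i+1}`. (The letter `w_i` is `w.getD (i - 1) 0`, all indices used being in range.) -/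
def wordDescents (w : List ℕ) : Finset ℕ :=
  {i ∈ Finset.Ico 1 w.length | w.getD i 0 < w.getD (i - 1) 0}

/-- The number of descents of a word. -/
def wordDes (w : List ℕ) : ℕ := (wordDescents w).card

/-- The major index of a word: the sum of its descents. -/
def wordMaj (w : List ℕ) : ℕ := ∑ i ∈ wordDescents w, i

/-- A doubloon of order `2 n + 1`: a filling of a `2 × (n+1)` matrix by the letters
`0, 1, …, 2 n + 1`, each used exactly once. -/
abbrev Doubloon (n : ℕ) : Type := Fin 2 × Fin (n + 1) ≃ Fin (2 * n + 2)

namespace Doubloon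

variable {n : ℕ}

/-- The entry `a_k` of the top row. -/
def top (δ : Doubloon n) (k : Fin (n + 1)) : ℕ := δ (0, k)

/-- The entry `b_k` of the bottom row. -/
def bot (δ : Doubloon n) (k : Fin (n + 1)) : ℕ := δ (1, k)

/-- The word `a_0 a_1 ⋯ a_n b_n ⋯ b_1 b_0`. -/
def word (δ : Doubloon n) : List ℕ := List.ofFn (top δ) ++ (List.ofFn (bot δ)).reverse

/-- The statistic `cmaj' δ = maj (a_0 ⋯ a_n b_n ⋯ b_0) - (n+1) des (a_0 ⋯ a_n b_n ⋯ b_0) + n²`,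
an integer. -/
def cmaj' (δ : Doubloon n) : ℤ :=
  (wordMaj (word δ) : ℤ) - ((n : ℤ) + 1) * (wordDes (word δ) : ℤ) + (n : ℤ) ^ 2

/-- A doubloon is interlaced if for every `k = 1, …, n` the sequence
`(a_{k-1}, a_k, b_{k-1}, b_k)`, or one of its three cyclic rearrangements, is monotonic increasing
or decreasing. -/
def Interlaced (δ : Doubloon n) : Prop :=
  ∀ k : Fin n, ∃ r ∈ Finset.range 4,
    (([top δ k.castSucc, top δ k.succ, bot δ k.castSucc, bot δ k.succ].rotate r).Pairwise
        (· < ·)) ∨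
      (([top δ k.castSucc, top δ k.succ, bot δ k.castSucc, bot δ k.succ].rotate r).Pairwise
        (· > ·))

/-- A doubloon is normalized if its top left entry `a_0` is `0`. -/
def Normalized (δ : Doubloon n) : Prop := top δ 0 = 0

instance : DecidablePred (Interlaced (n := n)) := fun δ => by
  unfold Interlaced; infer_instance

instance : DecidablePred (Normalized (n := n)) := fun δ => by
  unfold Normalized; infer_instance

end Doubloon

/-! ### The recurrence of the `q`-Eulerian polynomials -/

/-! The central coefficient is isolated by putting `t = -q^{-n}`: for `k ≤ n` the product `(-t q^k;
q)_{2n+2-2k}` then contains the factor `1 - q^0`, so only the term `k = n + 1` survives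
(`toLaurent_central`). Existence of the expansion is separate: a recurrence from `A_m` to `A_{m+1}`
sends each basis element to a combination of at most two of the next ones (`eulerianStep_basis`).

The value of `A_{2n+1}` at this point is computed combinatorially. `A_m` is the sum, over the
permutations of `0, …, m` beginning with `0`, of the product of `t q^i` over the descents `i`
counted from `0` (`descentSum_eq_carlitzEulerian`). Such permutations are the words of the
normalized doubloons when `m = 2n + 1`. At `t = -q^{-n}` the weight becomes, up to the common unit
`(-q^{-n})^n`, the signed monomial `(-1)^(n + des) q^(cmaj')`.

A sign-reversing involution finishes: at the first pair of adjacent columns that is not interlaced,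
swap the entries of every column to its right. This keeps `cmaj'` and changes the parity of `des`
(`cmaj'_macroFlip`, `odd_wordDes_add_macroFlip`). The survivors are the interlaced doubloons, whose
sign is `+1` (`even_wordDes_add_of_interlaced`). -/

theorem qShiftedFactorial_succ {R : Type*} [CommRing R] (x q : R) (m : ℕ) :
    qShiftedFactorial x q (m + 1) = qShiftedFactorial x q m * (1 - x * q ^ m) :=
  Finset.prod_range_succ _ _

theorem qShiftedFactorial_succ' {R : Type*} [CommRing R] (x q : R) (m : ℕ) :
    qShiftedFactorial x q (m + 1) = (1 - x) * qShiftedFactorial (x * q) q m := by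
  simp only [qShiftedFactorial]
  rw [Finset.prod_range_succ', mul_comm]
  simp [pow_succ', mul_assoc]

theorem map_qShiftedFactorial {R S : Type*} [CommRing R] [CommRing S] (f : R →+* S) (x q : R)
    (m : ℕ) : f (qShiftedFactorial x q m) = qShiftedFactorial (f x) (f q) m := by
  simp [qShiftedFactorial]

theorem one_sub_X_mul_qInt (m : ℕ) : (1 - X) * qInt m = 1 - X ^ m :=
  mul_neg_geom_sum X m

theorem qInt_succ (k : ℕ) : qInt (k + 1) = 1 + X * qInt k := by
  simp only [qInt]
  rw [Finset.sum_range_succ', Finset.mul_sum]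
  simp [pow_succ', add_comm]

/-- The substitution `t ↦ t q` in `ℤ[q]⟦t⟧`. -/
noncomputable abbrev scaleSeries : PowerSeries ℤ[X] →+* PowerSeries ℤ[X] :=
  PowerSeries.rescale X

theorem scaleSeries_X : scaleSeries PowerSeries.X = PowerSeries.X * qSeries := by
  rw [scaleSeries, PowerSeries.rescale_X, qSeries, mul_comm]

theorem scaleSeries_C (a : ℤ[X]) : scaleSeries (PowerSeries.C a) = PowerSeries.C a := by
  ext n
  rw [scaleSeries, PowerSeries.coeff_rescale, PowerSeries.coeff_C]
  split_ifs with h <;> simp [h]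

theorem scaleSeries_qSeries : scaleSeries qSeries = qSeries := scaleSeries_C X

/-- Since `(1 - q) [k+1]_q = 1 - q · q^k`, one more factor `[k+1]_q` in the coefficients becomes a
difference of the series and its rescaling. The two ways of splitting a factor off `(t; q)_{m+2}`
then clear the denominators. -/
theorem one_sub_mul_carlitzEulerian_succ (m : ℕ) :
    (1 - qSeries) * carlitzEulerian (m + 1) =
      (1 - PowerSeries.X * qSeries ^ (m + 1)) * carlitzEulerian m -
        qSeries * (1 - PowerSeries.X) * scaleSeries (carlitzEulerian m) := by
  have h : (1 - qSeries) * PowerSeries.mk (fun k => qInt (k + 1) ^ (m + 1)) =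
      PowerSeries.mk (fun k => qInt (k + 1) ^ m) -
        qSeries * scaleSeries (PowerSeries.mk (fun k => qInt (k + 1) ^ m)) := by
    ext1 k
    rw [qSeries, sub_mul, one_mul, map_sub, map_sub, PowerSeries.coeff_C_mul,
      PowerSeries.coeff_C_mul, scaleSeries, PowerSeries.coeff_rescale, PowerSeries.coeff_mk,
      PowerSeries.coeff_mk]
    linear_combination qInt (k + 1) ^ m * one_sub_X_mul_qInt (k + 1)
  simp only [carlitzEulerian, map_mul, map_qShiftedFactorial, scaleSeries_X, scaleSeries_qSeries]
  have h1 := qShiftedFactorial_succ (PowerSeries.X : PowerSeries ℤ[X]) qSeries (m + 1)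
  have h2 := qShiftedFactorial_succ' (PowerSeries.X : PowerSeries ℤ[X]) qSeries (m + 1)
  rw [← mul_assoc, h, sub_mul]
  nth_rw 1 [h1]
  rw [h2]
  ring

/-! ### Existence of the expansion -/

/-- The operator turning `A_m` into `(1 - q) A_{m+1}`. -/
noncomputable def eulerianStep (m : ℕ) (f : PowerSeries ℤ[X]) : PowerSeries ℤ[X] :=
  (1 - PowerSeries.X * qSeries ^ (m + 1)) * f - qSeries * (1 - PowerSeries.X) * scaleSeries f

/-- The series `t^(k-1) (-t q^k; q)_{m+1-2k}`. -/
noncomputable def eulerianBasis (m k : ℕ) : PowerSeries ℤ[X] :=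
  PowerSeries.X ^ (k - 1) *
    qShiftedFactorial (-(PowerSeries.X * qSeries ^ k)) qSeries (m + 1 - 2 * k)

theorem isEulerianExpansion_iff (m : ℕ) (a : ℕ → ℤ[X]) :
    IsEulerianExpansion m a ↔ carlitzEulerian m =
      ∑ k ∈ Finset.Icc 1 ((m + 1) / 2), PowerSeries.C (a k) * eulerianBasis m k := by
  simp only [IsEulerianExpansion, eulerianBasis, mul_assoc]

theorem eulerianStep_C_mul (m : ℕ) (a : ℤ[X]) (f : PowerSeries ℤ[X]) :
    eulerianStep m (PowerSeries.C a * f) = PowerSeries.C a * eulerianStep m f := by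
  simp only [eulerianStep, map_mul, scaleSeries_C]
  ring

theorem eulerianStep_sum {ι : Type*} (m : ℕ) (s : Finset ι) (f : ι → PowerSeries ℤ[X]) :
    eulerianStep m (∑ i ∈ s, f i) = ∑ i ∈ s, eulerianStep m (f i) := by
  simp only [eulerianStep, map_sum, Finset.mul_sum, Finset.sum_sub_distrib]

theorem C_qInt_mul (k : ℕ) : (1 - qSeries) * PowerSeries.C (qInt k) = 1 - qSeries ^ k := by
  simp only [qSeries, ← map_pow, ← map_one (PowerSeries.C (R := ℤ[X])), ← map_sub, ← map_mul,
    one_sub_X_mul_qInt]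

/-- Boundary case: the shifted factorial is empty, and no new basis index appears. -/
theorem eulerianStep_basis_of_eq (k : ℕ) :
    eulerianStep (2 * k + 1) (eulerianBasis (2 * k + 1) (k + 1)) =
      (1 - qSeries) * (PowerSeries.C (qInt (k + 1)) * eulerianBasis (2 * k + 2) (k + 1)) := by
  have e1 : 2 * k + 1 + 1 - 2 * (k + 1) = 0 := by omega
  have e2 : 2 * k + 2 + 1 - 2 * (k + 1) = 1 := by omega
  rw [← mul_assoc, C_qInt_mul]
  simp only [eulerianStep, eulerianBasis, e1, e2, map_mul, map_pow, scaleSeries_X,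
    qShiftedFactorial, Finset.prod_range_zero, Finset.prod_range_one, map_one,
    Nat.add_sub_cancel]
  ring

/-- Here `r + 1` is the number of factors of the shifted factorial. This product and its image under
`t ↦ t q` share the factor `(-t q^{k+2}; q)_r`, and the cofactors satisfy an elementary identity. -/
theorem eulerianStep_basis (k r : ℕ) :
    eulerianStep (2 * k + 2 + r) (eulerianBasis (2 * k + 2 + r) (k + 1)) =
      (1 - qSeries) * (PowerSeries.C (qInt (k + 1)) * eulerianBasis (2 * k + 3 + r) (k + 1) +
        PowerSeries.C (X ^ (k + 1) * (1 + X ^ (k + 1)) * qInt (r + 1)) *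
          eulerianBasis (2 * k + 3 + r) (k + 2)) := by
  have e1 : 2 * k + 2 + r + 1 - 2 * (k + 1) = r + 1 := by omega
  have e2 : 2 * k + 3 + r + 1 - 2 * (k + 1) = r + 2 := by omega
  have e3 : 2 * k + 3 + r + 1 - 2 * (k + 2) = r := by omega
  have hC : PowerSeries.C (X ^ (k + 1) * (1 + X ^ (k + 1)) * qInt (r + 1)) =
      qSeries ^ (k + 1) * (1 + qSeries ^ (k + 1)) * PowerSeries.C (qInt (r + 1)) := by
    simp [qSeries]
  have h1 := C_qInt_mul (k + 1)
  have h2 := C_qInt_mul (r + 1)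
  set A := PowerSeries.C (qInt (k + 1))
  set B := PowerSeries.C (qInt (r + 1))
  rw [hC]
  simp only [eulerianStep, eulerianBasis, e1, e2, e3, map_mul, map_pow, map_neg, scaleSeries_X,
    map_qShiftedFactorial, scaleSeries_qSeries, show k + 2 - 1 = k + 1 from rfl,
    Nat.add_sub_cancel]
  have g1 := qShiftedFactorial_succ' (-(PowerSeries.X * qSeries ^ (k + 1))) qSeries r
  have g2 := qShiftedFactorial_succ (-(PowerSeries.X * qSeries ^ (k + 1))) qSeries (r + 1)
  have g3 := qShiftedFactorial_succ (-(PowerSeries.X * qSeries * qSeries ^ (k + 1))) qSeries r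
  have q1 : -(PowerSeries.X * qSeries ^ (k + 1)) * qSeries =
      -(PowerSeries.X * qSeries ^ (k + 2)) := by ring
  have q2 : -(PowerSeries.X * qSeries * qSeries ^ (k + 1)) =
      -(PowerSeries.X * qSeries ^ (k + 2)) := by ring
  rw [q1] at g1
  rw [q2] at g3 ⊢
  rw [g2, g1, g3]
  set Q := qShiftedFactorial (-(PowerSeries.X * qSeries ^ (k + 2))) qSeries r
  linear_combination (-(PowerSeries.X ^ k * (1 + PowerSeries.X * qSeries ^ (k + 1)) * Q *
    (1 + PowerSeries.X * qSeries ^ (k + 1) * qSeries ^ (r + 1)))) * h1 -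
    (PowerSeries.X ^ (k + 1) * qSeries ^ (k + 1) * (1 + qSeries ^ (k + 1)) * Q) * h2

theorem C_mul_eulerianBasis_eq_sum (m M l : ℕ) (hl : l ∈ Finset.Icc 1 M) (c : ℤ[X]) :
    PowerSeries.C c * eulerianBasis m l = ∑ k ∈ Finset.Icc 1 M,
      PowerSeries.C (if k = l then c else 0) * eulerianBasis m k := by
  rw [Finset.sum_eq_single_of_mem l hl, if_pos rfl]
  intro k _ hk
  rw [if_neg hk, map_zero, zero_mul]

theorem eulerianStep_basis_mem (m k : ℕ) (hk : k ∈ Finset.Icc 1 ((m + 1) / 2)) :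
    ∃ b : ℕ → ℤ[X], eulerianStep m (eulerianBasis m k) =
      (1 - qSeries) *
        ∑ l ∈ Finset.Icc 1 ((m + 2) / 2), PowerSeries.C (b l) * eulerianBasis (m + 1) l := by
  rw [Finset.mem_Icc] at hk
  obtain ⟨k, rfl⟩ := Nat.exists_eq_add_of_le' hk.1
  have hk1 : k + 1 ∈ Finset.Icc 1 ((m + 2) / 2) := Finset.mem_Icc.2 ⟨by omega, by omega⟩
  obtain h | ⟨r, h⟩ : m = 2 * k + 1 ∨ ∃ r, m = 2 * k + 2 + r := by
    by_cases h : m = 2 * k + 1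
    · exact Or.inl h
    · exact Or.inr ⟨m - (2 * k + 2), by omega⟩
  · refine ⟨fun l => if l = k + 1 then qInt (k + 1) else 0, ?_⟩
    rw [← C_mul_eulerianBasis_eq_sum _ _ _ hk1, h, eulerianStep_basis_of_eq]
  · have hk2 : k + 2 ∈ Finset.Icc 1 ((m + 2) / 2) := Finset.mem_Icc.2 ⟨by omega, by omega⟩
    refine ⟨fun l => (if l = k + 1 then qInt (k + 1) else 0) +
      (if l = k + 2 then X ^ (k + 1) * (1 + X ^ (k + 1)) * qInt (r + 1) else 0), ?_⟩
    simp only [map_add, add_mul, Finset.sum_add_distrib]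
    rw [← C_mul_eulerianBasis_eq_sum _ _ _ hk1, ← C_mul_eulerianBasis_eq_sum _ _ _ hk2, h,
      eulerianStep_basis, show 2 * k + 2 + r + 1 = 2 * k + 3 + r by omega]

theorem one_sub_qSeries_ne_zero : (1 - qSeries) ≠ 0 := by
  have h : (1 - qSeries) = PowerSeries.C (1 - X : ℤ[X]) := by simp [qSeries]
  rw [h, Ne, map_eq_zero_iff _ PowerSeries.C_injective]
  intro h'
  simpa using congrArg (Polynomial.eval 0) h'

/-- The induction starts at index `1`: for index `0` the sum is empty, whereas `A_0 = 1`. -/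
theorem exists_isEulerianExpansion (m : ℕ) : ∃ a, IsEulerianExpansion (m + 1) a := by
  induction m with
  | zero =>
    refine ⟨1, ?_⟩
    rw [isEulerianExpansion_iff]
    apply mul_left_cancel₀ one_sub_qSeries_ne_zero
    have h0 : carlitzEulerian 0 = 1 := by
      simp only [carlitzEulerian, qShiftedFactorial, pow_zero, zero_add,
        Finset.prod_range_one, mul_one]
      exact PowerSeries.mk_one_mul_one_sub_eq_one ℤ[X]
    rw [one_sub_mul_carlitzEulerian_succ, h0]
    simp [eulerianBasis, qShiftedFactorial]
    ring
  | succ m ih =>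
    obtain ⟨a, ha⟩ := ih
    rw [isEulerianExpansion_iff] at ha
    choose! b hb using eulerianStep_basis_mem (m + 1)
    refine ⟨fun l => ∑ k ∈ Finset.Icc 1 ((m + 1 + 1) / 2), a k * b k l, ?_⟩
    rw [isEulerianExpansion_iff]
    apply mul_left_cancel₀ one_sub_qSeries_ne_zero
    rw [one_sub_mul_carlitzEulerian_succ]
    change eulerianStep (m + 1) (carlitzEulerian (m + 1)) = _
    rw [ha, eulerianStep_sum]
    simp only [map_sum, Finset.sum_mul, eulerianStep_C_mul]
    rw [Finset.sum_comm, Finset.mul_sum]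
    refine Finset.sum_congr rfl fun k hk => ?_
    rw [hb k hk, ← mul_assoc, mul_comm (PowerSeries.C (a k)), mul_assoc, Finset.mul_sum]
    simp only [map_mul, mul_assoc]

/-! ### The `q`-Eulerian polynomials as generating functions of permutations -/

/-- The permutation of `Fin (m + 1)` with last letter `j` whose other letters are in the same
relative order as those of `w`. -/
def snocPerm {m : ℕ} (j : Fin (m + 1)) (w : Equiv.Perm (Fin m)) : Equiv.Perm (Fin (m + 1)) :=
  (finSuccEquivLast.trans (Equiv.optionCongr w)).trans (finSuccEquiv' j).symm

theorem snocPerm_last {m : ℕ} (j : Fin (m + 1)) (w : Equiv.Perm (Fin m)) :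
    snocPerm j w (Fin.last m) = j := by
  simp [snocPerm]

theorem snocPerm_castSucc {m : ℕ} (j : Fin (m + 1)) (w : Equiv.Perm (Fin m)) (i : Fin m) :
    snocPerm j w i.castSucc = j.succAbove (w i) := by
  simp [snocPerm]

theorem snocPerm_bijective (m : ℕ) :
    Function.Bijective fun p : Fin (m + 1) × Equiv.Perm (Fin m) => snocPerm p.1 p.2 := by
  rw [Fintype.bijective_iff_injective_and_card]
  refine ⟨?_, by simp [Fintype.card_perm, Nat.factorial_succ]⟩
  rintro ⟨j, w⟩ ⟨j', w'⟩ h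
  have hj : j = j' := by
    simpa [snocPerm_last] using congrArg (fun v => v (Fin.last m)) h
  subst hj
  refine Prod.ext rfl (Equiv.ext fun i => ?_)
  simpa [snocPerm_castSucc] using congrArg (fun v => v i.castSucc) h

theorem sum_snocPerm {m : ℕ} {M : Type*} [AddCommMonoid M] (f : Equiv.Perm (Fin (m + 1)) → M) :
    ∑ w, f w = ∑ j, ∑ w, f (snocPerm j w) := by
  rw [← Fintype.sum_prod_type']
  exact (Fintype.sum_bijective _ (snocPerm_bijective m) _ _ fun _ => rfl).symm

section Weight

variable {R : Type*} [CommRing R]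

/-- The product of `x i` over the descents `i` (counted from `0`) of the word
`w 0, …, w m`. -/
def descentWeight (x : ℕ → R) {m : ℕ} (w : Equiv.Perm (Fin (m + 1))) : R :=
  ∏ i : Fin m, if w i.succ < w i.castSucc then x i else 1

/-- Making room for the letter `j` preserves the relative order of the others, so only position `m`
can add a descent. -/
theorem descentWeight_snocPerm (x : ℕ → R) {m : ℕ} (j : Fin (m + 2))
    (w : Equiv.Perm (Fin (m + 1))) :
    descentWeight x (snocPerm j w) =
      (if (w (Fin.last m) : ℕ) < j then 1 else x m) * descentWeight x w := by
  rw [descentWeight, Fin.prod_univ_castSucc, mul_comm]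
  congr 1
  · rw [Fin.succ_last, snocPerm_last, snocPerm_castSucc, Fin.val_last]
    simp only [Fin.lt_succAbove_iff_le_castSucc, Fin.le_def, Fin.val_castSucc]
    split_ifs <;> first | rfl | omega
  · refine Finset.prod_congr rfl fun i _ => ?_
    rw [Fin.succ_castSucc, snocPerm_castSucc, snocPerm_castSucc, Fin.val_castSucc]
    simp only [(Fin.strictMono_succAbove j).lt_iff_lt]

/-- The sum of the weights of the permutations of `0, …, m` that begin with `0` and end
with `j`. -/
def endingSum (x : ℕ → R) (m : ℕ) (j : Fin (m + 1)) : R :=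
  ∑ w : Equiv.Perm (Fin (m + 1)), if w 0 = 0 ∧ w (Fin.last m) = j then descentWeight x w else 0

/-- The sum of the weights of the permutations of `0, …, m` that begin with `0`. -/
def descentSum (x : ℕ → R) (m : ℕ) : R :=
  ∑ w : Equiv.Perm (Fin (m + 1)), if w 0 = 0 then descentWeight x w else 0

theorem map_descentSum {S : Type*} [CommRing S] (f : R →+* S) (x : ℕ → R) (m : ℕ) :
    f (descentSum x m) = descentSum (fun i => f (x i)) m := by
  simp only [descentSum, descentWeight, map_sum, apply_ite f, map_prod, map_zero, map_one]

theorem sum_endingSum (x : ℕ → R) (m : ℕ) : ∑ j, endingSum x m j = descentSum x m := by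
  simp only [endingSum, descentSum]
  rw [Finset.sum_comm]
  refine Finset.sum_congr rfl fun w _ => ?_
  by_cases h : w 0 = 0 <;> simp [h]

theorem endingSum_zero (x : ℕ → R) (j : Fin 1) : endingSum x 0 j = 1 := by
  have hs : Subsingleton (Fin (0 + 1)) := inferInstanceAs (Subsingleton (Fin 1))
  rw [endingSum, Fintype.sum_subsingleton _ (1 : Equiv.Perm (Fin (0 + 1))),
    if_pos ⟨Subsingleton.elim _ _, Subsingleton.elim _ _⟩, descentWeight, Fin.prod_univ_zero]

theorem endingSum_succ_zero (x : ℕ → R) (m : ℕ) : endingSum x (m + 1) 0 = 0 := by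
  refine Finset.sum_eq_zero fun w _ => if_neg ?_
  rintro ⟨h, h'⟩
  exact (Fin.last_pos.ne (w.injective (h.trans h'.symm))).elim

/-- Delete the last letter and sum over the new last letter `i`. The deleted letter is positive, so
the initial `0` stays `0`. -/
theorem endingSum_succ_succ (x : ℕ → R) (m : ℕ) (j : Fin (m + 1)) :
    endingSum x (m + 1) j.succ =
      ∑ i : Fin (m + 1), (if (i : ℕ) < j + 1 then 1 else x m) * endingSum x m i := by
  simp only [endingSum]
  rw [sum_snocPerm, Finset.sum_eq_single j.succ]
  · simp only [Finset.mul_sum]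
    rw [Finset.sum_comm]
    refine Finset.sum_congr rfl fun w _ => ?_
    rw [Finset.sum_eq_single (w (Fin.last m))]
    · rw [snocPerm_last, descentWeight_snocPerm, ← Fin.castSucc_zero, snocPerm_castSucc,
        Fin.castSucc_zero, Fin.val_succ]
      simp only [Fin.succAbove_eq_zero_iff (Fin.succ_ne_zero j)]
      by_cases h : w 0 = 0 <;> simp [h]
    · intro i _ hi
      simp [hi.symm]
    · simp
  · intro i _ hi
    simp [snocPerm_last, hi]
  · simp

end Weight

/-- The series `∑_k (q [k]_q)^a [k+1]_q^b t^k`. -/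
noncomputable def qPowerSeries (a b : ℕ) : PowerSeries ℤ[X] :=
  PowerSeries.mk fun k => (X * qInt k) ^ a * qInt (k + 1) ^ b

/-- This is `[k+1]_q - q [k]_q = 1`, the source of the telescoping below. -/
theorem qPowerSeries_sub (a b : ℕ) :
    qPowerSeries a (b + 1) - qPowerSeries (a + 1) b = qPowerSeries a b := by
  ext1 k
  simp only [qPowerSeries, map_sub, PowerSeries.coeff_mk, qInt_succ]
  ring

theorem X_mul_qPowerSeries (m : ℕ) :
    PowerSeries.X * qSeries ^ (m + 1) * qPowerSeries 0 (m + 1) = qPowerSeries (m + 1) 0 := by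
  ext1 k
  rw [mul_assoc]
  cases k with
  | zero => simp [qPowerSeries, qInt]
  | succ k =>
    rw [PowerSeries.coeff_succ_X_mul, qSeries, ← map_pow, PowerSeries.coeff_C_mul]
    simp only [qPowerSeries, PowerSeries.coeff_mk]
    ring

theorem sum_qPowerSeries (m j : ℕ) (hj : j ≤ m + 1) :
    ∑ i ∈ Finset.range j, qPowerSeries (m - i) i =
      qPowerSeries (m + 1 - j) j - qPowerSeries (m + 1) 0 := by
  induction j with
  | zero => simp
  | succ j ih =>
    rw [Finset.sum_range_succ, ih (by omega), ← qPowerSeries_sub (m - j),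
      show m - j + 1 = m + 1 - j by omega, show m + 1 - (j + 1) = m - j by omega]
    ring

/-- Refining by the last letter makes the induction possible. The sum over the previous last letter
splits at `j` into two telescoping pieces, and `X_mul_qPowerSeries` leaves exactly the new factor `1
- t q^{m+1}`. -/
theorem endingSum_eq (m : ℕ) (j : Fin (m + 1)) :
    endingSum (fun i => PowerSeries.X * qSeries ^ i) (m + 1) j.succ =
      qShiftedFactorial PowerSeries.X qSeries (m + 1) * qPowerSeries (m - j) j := by
  induction m with
  | zero =>
    rw [endingSum_succ_succ]
    simp only [endingSum_zero, Fin.val_eq_zero, qShiftedFactorial, qPowerSeries]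
    simp only [pow_zero, zero_add, Finset.prod_range_one, mul_one, Nat.sub_self, zero_lt_one,
      if_true]
    rw [mul_comm, Finset.sum_const, Finset.card_univ, Fintype.card_fin, zero_add, one_nsmul]
    exact (PowerSeries.mk_one_mul_one_sub_eq_one ℤ[X]).symm
  | succ m ih =>
    rw [endingSum_succ_succ, Fin.sum_univ_succ, endingSum_succ_zero, mul_zero, zero_add]
    simp only [ih, Fin.val_succ, add_lt_add_iff_right]
    have hj : (j : ℕ) ≤ m + 1 := by omega
    generalize (j : ℕ) = j at hj
    rw [Fin.sum_univ_eq_sum_range (fun i => (if i < j then 1 else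
      PowerSeries.X * qSeries ^ (m + 1)) *
      (qShiftedFactorial PowerSeries.X qSeries (m + 1) * qPowerSeries (m - i) i)),
      ← Finset.sum_range_add_sum_Ico _ hj]
    have h1 : ∀ i ∈ Finset.range j, (if i < j then 1 else
        PowerSeries.X * qSeries ^ (m + 1)) *
        (qShiftedFactorial PowerSeries.X qSeries (m + 1) * qPowerSeries (m - i) i) =
        qShiftedFactorial PowerSeries.X qSeries (m + 1) * qPowerSeries (m - i) i := by
      intro i hi
      rw [if_pos (Finset.mem_range.1 hi), one_mul]
    have h2 : ∀ i ∈ Finset.Ico j (m + 1), (if i < j then 1 else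
        PowerSeries.X * qSeries ^ (m + 1)) *
        (qShiftedFactorial PowerSeries.X qSeries (m + 1) * qPowerSeries (m - i) i) =
        PowerSeries.X * qSeries ^ (m + 1) *
        (qShiftedFactorial PowerSeries.X qSeries (m + 1) * qPowerSeries (m - i) i) := by
      intro i hi
      rw [if_neg (not_lt.2 (Finset.mem_Ico.1 hi).1)]
    rw [Finset.sum_congr rfl h1, Finset.sum_congr rfl h2, ← Finset.mul_sum, ← Finset.mul_sum,
      ← Finset.mul_sum, Finset.sum_Ico_eq_sub _ hj, sum_qPowerSeries m j hj,
      sum_qPowerSeries m (m + 1) le_rfl, Nat.sub_self, qShiftedFactorial_succ _ _ (m + 1)]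
    linear_combination qShiftedFactorial PowerSeries.X qSeries (m + 1) * X_mul_qPowerSeries m

theorem descentSum_eq_carlitzEulerian (m : ℕ) :
    descentSum (fun i => PowerSeries.X * qSeries ^ i) (m + 1) = carlitzEulerian (m + 1) := by
  rw [← sum_endingSum, Fin.sum_univ_succ, endingSum_succ_zero, zero_add]
  simp only [endingSum_eq]
  rw [← Finset.mul_sum, Fin.sum_univ_eq_sum_range (fun i => qPowerSeries (m - i) i),
    sum_qPowerSeries m (m + 1) le_rfl, Nat.sub_self, ← X_mul_qPowerSeries, carlitzEulerian,
    qShiftedFactorial_succ _ _ (m + 1)]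
  simp only [qPowerSeries, pow_zero, one_mul]
  ring

/-! ### Evaluation at `t = -q^{-n}` -/

theorem toLaurent_central (n : ℕ) (a : ℕ → ℤ[X]) (h : IsEulerianExpansion (2 * n + 1) a) :
    descentSum (fun i => -(LaurentPolynomial.T ((i : ℤ) - n) : ℤ[T;T⁻¹])) (2 * n + 1) =
      toLaurent (a (n + 1)) * (-LaurentPolynomial.T (-n : ℤ)) ^ n := by
  rw [IsEulerianExpansion, ← descentSum_eq_carlitzEulerian] at h
  -- A power series cannot be evaluated at `-q^{-n}`. Both sides are polynomials in `t`, so the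
  -- identity is first pulled back to `ℤ[q][t]`.
  have hp : descentSum (fun i => (X : ℤ[X][X]) * C X ^ i) (2 * n + 1) =
      ∑ k ∈ Finset.Icc 1 ((2 * n + 1 + 1) / 2), C (a k) * X ^ (k - 1) *
        qShiftedFactorial (-(X * C X ^ k) : ℤ[X][X]) (C X) (2 * n + 1 + 1 - 2 * k) := by
    apply Polynomial.coe_injective
    rw [← Polynomial.coeToPowerSeries.ringHom_apply, ← Polynomial.coeToPowerSeries.ringHom_apply]
    rw [map_descentSum]
    simp only [map_sum, map_mul, map_pow, map_qShiftedFactorial, map_neg]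
    simpa [qSeries] using h
  have he := congrArg (Polynomial.eval₂RingHom (toLaurent (R := ℤ))
    (-LaurentPolynomial.T (-n : ℤ))) hp
  rw [map_descentSum] at he
  simp only [map_sum, map_mul, map_pow, map_qShiftedFactorial, map_neg,
    Polynomial.coe_eval₂RingHom, Polynomial.eval₂_X, Polynomial.eval₂_C,
    Polynomial.toLaurent_X, LaurentPolynomial.T_pow, neg_mul, neg_neg,
    ← LaurentPolynomial.T_add] at he
  rw [Finset.sum_eq_single (n + 1)] at he
  · rw [show 2 * n + 1 + 1 - 2 * (n + 1) = 0 by omega] at he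
    simp only [qShiftedFactorial, Finset.prod_range_zero, mul_one, Nat.add_sub_cancel] at he
    rw [← he]
    congr 1
    funext i
    congr 2
    ring
  · intro k hk hkn
    rw [Finset.mem_Icc] at hk
    -- The product is now `(q^{k-n}; q)_{2n+2-2k}`; its factor of index `n - k` is `1 - q^0`.
    rw [qShiftedFactorial, Finset.prod_eq_zero (i := n - k), mul_zero]
    · rw [Finset.mem_range]; omega
    · rw [LaurentPolynomial.T_pow, ← LaurentPolynomial.T_add, sub_eq_zero,
        ← LaurentPolynomial.T_zero]
      congr 1
      push_cast [show k ≤ n by omega]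
      ring
  · intro hn
    exact absurd (Finset.mem_Icc.2 ⟨by omega, by omega⟩) hn

/-! ### The word of a doubloon -/

namespace Doubloon

variable {n : ℕ}

theorem length_word (δ : Doubloon n) : (word δ).length = 2 * n + 2 := by
  simp [word]
  omega

theorem word_getD_top (δ : Doubloon n) (k : Fin (n + 1)) : (word δ).getD k 0 = top δ k := by
  have hk := k.2
  rw [List.getD_eq_getElem _ _ (by rw [length_word]; omega)]
  simp only [word]
  rw [List.getElem_append_left (by simp; omega), List.getElem_ofFn]

theorem word_getD_bot (δ : Doubloon n) (k : Fin (n + 1)) :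
    (word δ).getD (2 * n + 1 - k) 0 = bot δ k := by
  have hk := k.2
  rw [List.getD_eq_getElem _ _ (by rw [length_word]; omega)]
  simp only [word]
  rw [List.getElem_append_right (by simp; omega), List.getElem_reverse, List.getElem_ofFn]
  congr 1
  ext
  simp
  omega

theorem sum_wordDescents (δ : Doubloon n) (g : ℕ → ℤ) :
    ∑ i ∈ wordDescents (word δ), g i =
      ∑ k : Fin n, ((if top δ k.succ < top δ k.castSucc then g (k + 1) else 0) +
        (if bot δ k.castSucc < bot δ k.succ then g (2 * n + 1 - k) else 0)) +
        (if bot δ (Fin.last n) < top δ (Fin.last n) then g (n + 1) else 0) := by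
  rw [wordDescents, Finset.sum_filter, length_word, Finset.sum_Ico_eq_sum_range,
    show 2 * n + 2 - 1 = n + 1 + n by omega, Finset.sum_range_add, Finset.sum_range_succ,
    Finset.sum_add_distrib, add_right_comm]
  congr 1
  · congr 1
    · rw [← Fin.sum_univ_eq_sum_range (fun i => if (word δ).getD (1 + i) 0 <
        (word δ).getD (1 + i - 1) 0 then g (1 + i) else 0)]
      refine Finset.sum_congr rfl fun k _ => ?_
      rw [← word_getD_top, ← word_getD_top, Fin.val_succ, Fin.val_castSucc, Nat.add_comm 1,
        Nat.add_sub_cancel]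
    · rw [← Finset.sum_range_reflect, ← Fin.sum_univ_eq_sum_range (fun i =>
        if (word δ).getD (1 + (n + 1 + (n - 1 - i))) 0 <
        (word δ).getD (1 + (n + 1 + (n - 1 - i)) - 1) 0 then
        g (1 + (n + 1 + (n - 1 - i))) else 0)]
      refine Finset.sum_congr rfl fun k _ => ?_
      have hk := k.2
      rw [← word_getD_bot, ← word_getD_bot, Fin.val_succ, Fin.val_castSucc,
        show 1 + (n + 1 + (n - 1 - (k : ℕ))) = 2 * n + 1 - k by omega,
        show 2 * n + 1 - (k : ℕ) - 1 = 2 * n + 1 - (k + 1) by omega]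
  · rw [← word_getD_bot, ← word_getD_top, Fin.val_last, Nat.add_comm 1, Nat.add_sub_cancel,
      show 2 * n + 1 - n = n + 1 by omega]

theorem wordDes_eq (δ : Doubloon n) :
    (wordDes (word δ) : ℤ) =
      ∑ k : Fin n, ((if top δ k.succ < top δ k.castSucc then 1 else 0) +
        (if bot δ k.castSucc < bot δ k.succ then 1 else 0)) +
        (if bot δ (Fin.last n) < top δ (Fin.last n) then 1 else 0) := by
  rw [← sum_wordDescents δ fun _ => 1]
  simp [wordDes]

theorem cmaj'_eq_sum_wordDescents (δ : Doubloon n) :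
    cmaj' δ = ∑ i ∈ wordDescents (word δ), ((i : ℤ) - (n + 1)) + (n : ℤ) ^ 2 := by
  rw [cmaj', wordMaj, wordDes, Finset.sum_sub_distrib, Finset.sum_const, nsmul_eq_mul]
  push_cast
  ring

/-- A descent at position `i` counts `i - (n + 1)`. Positions `k + 1` (top row) and `2n + 1 - k`
(bottom row, read backwards) get opposite values, and the middle position gets `0`. -/
theorem cmaj'_eq (δ : Doubloon n) :
    cmaj' δ = ∑ k : Fin n, ((n : ℤ) - k) *
      ((if bot δ k.castSucc < bot δ k.succ then 1 else 0) -
        (if top δ k.succ < top δ k.castSucc then 1 else 0)) + (n : ℤ) ^ 2 := by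
  rw [cmaj'_eq_sum_wordDescents, sum_wordDescents δ fun i => (i : ℤ) - (n + 1)]
  have h : ((n + 1 : ℕ) : ℤ) - (n + 1) = 0 := by push_cast; ring
  rw [h, ite_self, add_zero]
  congr 1
  refine Finset.sum_congr rfl fun k _ => ?_
  have hk := k.2
  rw [Nat.cast_sub (by omega)]
  push_cast
  split_ifs <;> ring

theorem top_ne_top (δ : Doubloon n) {i j : Fin (n + 1)} (h : i ≠ j) : top δ i ≠ top δ j := by
  simpa [top, Fin.val_inj] using h

theorem bot_ne_bot (δ : Doubloon n) {i j : Fin (n + 1)} (h : i ≠ j) : bot δ i ≠ bot δ j := by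
  simpa [bot, Fin.val_inj] using h

theorem top_ne_bot (δ : Doubloon n) (i j : Fin (n + 1)) : top δ i ≠ bot δ j := by
  simp [top, bot, Fin.val_inj]

/-! ### Interlaced columns -/

/-- The columns `k` and `k + 1` of a doubloon are interlaced: exactly one of the entries of
column `k + 1` lies between the two entries of column `k`. -/
def InterlacedAt (δ : Doubloon n) (k : Fin n) : Prop :=
  ¬ ((top δ k.castSucc < top δ k.succ ↔ top δ k.succ < bot δ k.castSucc) ↔
    (top δ k.castSucc < bot δ k.succ ↔ bot δ k.succ < bot δ k.castSucc))

theorem column_ne (δ : Doubloon n) (k : Fin n) :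
    top δ k.castSucc ≠ top δ k.succ ∧ bot δ k.castSucc ≠ bot δ k.succ ∧
      top δ k.castSucc ≠ bot δ k.castSucc ∧ top δ k.castSucc ≠ bot δ k.succ ∧
      top δ k.succ ≠ bot δ k.castSucc ∧ top δ k.succ ≠ bot δ k.succ :=
  ⟨top_ne_top δ (Fin.castSucc_lt_succ).ne, bot_ne_bot δ (Fin.castSucc_lt_succ).ne,
    top_ne_bot _ _ _, top_ne_bot _ _ _, top_ne_bot _ _ _, top_ne_bot _ _ _⟩

theorem exists_rotate_monotone_iff (p x r y : ℕ) (h1 : p ≠ x) (h2 : r ≠ y) (h3 : p ≠ r)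
    (h4 : p ≠ y) (h5 : x ≠ r) (h6 : x ≠ y) :
    (∃ i ∈ Finset.range 4, ([p, x, r, y].rotate i).Pairwise (· < ·) ∨
      ([p, x, r, y].rotate i).Pairwise (· > ·)) ↔
      ¬ ((p < x ↔ x < r) ↔ (p < y ↔ y < r)) := by
  have hr : ∀ P : ℕ → Prop, (∃ i ∈ Finset.range 4, P i) ↔ P 0 ∨ P 1 ∨ P 2 ∨ P 3 := by
    intro P
    simp [Finset.range_add_one]
    tauto
  rw [hr]
  simp only [List.rotate, List.length_cons, List.length_nil, List.splitAt_eq, List.take, List.drop,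
    List.cons_append, List.nil_append, List.pairwise_cons, List.mem_cons, List.not_mem_nil,
    forall_eq_or_imp, or_false, forall_eq, Nat.reduceAdd, Nat.reduceMod,
    List.Pairwise.nil, IsEmpty.forall_iff, implies_true, and_true, gt_iff_lt, List.append_nil]
  obtain a1 | a1 := h1.lt_or_gt <;> obtain a2 | a2 := h2.lt_or_gt <;>
  obtain a3 | a3 := h3.lt_or_gt <;> obtain a4 | a4 := h4.lt_or_gt <;>
  obtain a5 | a5 := h5.lt_or_gt <;> obtain a6 | a6 := h6.lt_or_gt <;>
  simp only [a1, a2, a3, a4, a5, a6, a1.not_gt, a2.not_gt, a3.not_gt, a4.not_gt, a5.not_gt,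
    a6.not_gt] <;> first | (simp; done) | omega

theorem interlaced_iff (δ : Doubloon n) : Interlaced δ ↔ ∀ k, InterlacedAt δ k := by
  refine forall_congr' fun k => ?_
  obtain ⟨h1, h2, h3, h4, h5, h6⟩ := column_ne δ k
  exact exists_rotate_monotone_iff _ _ _ _ h1 h2 h3 h4 h5 h6

/-- Let `s k` indicate that column `k` decreases downwards. For interlaced columns, the number of
descents they contribute plus the change of `s` is odd. The changes telescope from `s 0 = 0` to `s
n`, which is the middle descent. -/
theorem even_wordDes_add_of_interlaced (δ : Doubloon n) (h : Interlaced δ) (h0 : Normalized δ) :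
    Even ((n : ℤ) + wordDes (word δ)) := by
  rw [interlaced_iff] at h
  rw [wordDes_eq]
  set s : Fin (n + 1) → ℤ := fun k => if bot δ k < top δ k then 1 else 0 with hs
  have hs0 : s 0 = 0 := by
    have h0 : top δ 0 = 0 := h0
    simp [hs, h0]
  have htel : ∑ k : Fin n, (s k.succ - s k.castSucc) = s (Fin.last n) := by
    have h1 := Fin.sum_univ_succ s
    have h2 := Fin.sum_univ_castSucc s
    rw [Finset.sum_sub_distrib]
    linarith
  have hev : Even (∑ k : Fin n, ((if top δ k.succ < top δ k.castSucc then (1 : ℤ) else 0) +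
      (if bot δ k.castSucc < bot δ k.succ then 1 else 0) + (s k.succ - s k.castSucc) - 1)) := by
    refine Finset.even_sum _ fun k _ => ?_
    obtain ⟨h1, h2, h3, h4, h5, h6⟩ := column_ne δ k
    have hk := h k
    rw [InterlacedAt] at hk
    simp only [hs]
    rw [Int.even_iff]
    split_ifs <;> omega
  rw [Finset.sum_sub_distrib, Finset.sum_add_distrib, htel] at hev
  simp only [Finset.sum_const, Finset.card_univ, Fintype.card_fin, nsmul_eq_mul, mul_one] at hev
  rw [Int.even_iff] at hev ⊢
  simp only [hs] at hev
  omega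

/-! ### Macro flips -/

/-- The involution of the cells exchanging the two cells of each of the columns `k, k + 1, …`. -/
def cellFlip (n k : ℕ) : Equiv.Perm (Fin 2 × Fin (n + 1)) :=
  Function.Involutive.toPerm (fun c => if k ≤ c.2 then (c.1.rev, c.2) else c) fun c => by
    by_cases h : k ≤ c.2 <;> simp [h]

/-- Exchange the two entries of each of the columns `k, k + 1, …`. -/
def macroFlip (k : ℕ) (δ : Doubloon n) : Doubloon n := (cellFlip n k).trans δ

theorem macroFlip_macroFlip (k : ℕ) (δ : Doubloon n) : macroFlip k (macroFlip k δ) = δ :=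
  Equiv.ext fun c => congrArg δ ((cellFlip n k).symm_apply_apply c)

theorem top_macroFlip (k : ℕ) (δ : Doubloon n) (j : Fin (n + 1)) :
    top (macroFlip k δ) j = if k ≤ j then bot δ j else top δ j := by
  by_cases h : k ≤ j <;> simp [macroFlip, cellFlip, top, bot, h, Function.Involutive.toPerm]

theorem bot_macroFlip (k : ℕ) (δ : Doubloon n) (j : Fin (n + 1)) :
    bot (macroFlip k δ) j = if k ≤ j then top δ j else bot δ j := by
  by_cases h : k ≤ j <;> simp [macroFlip, cellFlip, top, bot, h, Function.Involutive.toPerm]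

theorem interlacedAt_macroFlip (k : ℕ) (δ : Doubloon n) (j : Fin n) :
    InterlacedAt (macroFlip k δ) j ↔ InterlacedAt δ j := by
  obtain ⟨h1, h2, h3, h4, h5, h6⟩ := column_ne δ j
  simp only [InterlacedAt, top_macroFlip, bot_macroFlip]
  split_ifs <;> omega

/-- Each difference in `cmaj'_eq` is invariant. Right of the gap, the bottom ascent and top descent
indicators `u`, `v` become `1 - v`, `1 - u`. At the gap, `[x < a_k] - [x < b_k]` depends only on
whether `x` lies between `a_k` and `b_k`, hence agrees for `x = a_{k+1}` and `x = b_{k+1}`. -/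
theorem cmaj'_macroFlip (δ : Doubloon n) (k : Fin n) (hk : ¬ InterlacedAt δ k) :
    cmaj' (macroFlip (k + 1) δ) = cmaj' δ := by
  rw [cmaj'_eq, cmaj'_eq]
  congr 1
  refine Finset.sum_congr rfl fun j _ => ?_
  congr 1
  obtain ⟨h1, h2, h3, h4, h5, h6⟩ := column_ne δ j
  simp only [top_macroFlip, bot_macroFlip, Fin.val_succ, Fin.val_castSucc]
  rw [InterlacedAt] at hk
  obtain h | rfl | h := lt_trichotomy j k
  · rw [Fin.lt_def] at h
    simp only [if_neg (show ¬ (k : ℕ) + 1 ≤ j + 1 by omega),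
      if_neg (show ¬ (k : ℕ) + 1 ≤ j by omega)]
  · simp only [if_pos (le_refl ((j : ℕ) + 1)), if_neg (Nat.not_succ_le_self (j : ℕ))]
    split_ifs <;> omega
  · rw [Fin.lt_def] at h
    simp only [if_pos (show (k : ℕ) + 1 ≤ j + 1 by omega),
      if_pos (show (k : ℕ) + 1 ≤ j by omega)]
    split_ifs <;> omega

/-- Every pair of adjacent columns contributes an even total to the two descent numbers. The middle
position is a descent of exactly one of the two words, because the last column is flipped. -/
theorem odd_wordDes_add_macroFlip (δ : Doubloon n) (k : Fin n) (hk : ¬ InterlacedAt δ k) :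
    Odd ((wordDes (word (macroFlip (k + 1) δ)) : ℤ) + wordDes (word δ)) := by
  rw [wordDes_eq, wordDes_eq, add_add_add_comm, ← Finset.sum_add_distrib]
  refine Even.add_odd (Finset.even_sum _ fun j _ => ?_) ?_
  · obtain ⟨h1, h2, h3, h4, h5, h6⟩ := column_ne δ j
    simp only [top_macroFlip, bot_macroFlip, Fin.val_succ, Fin.val_castSucc]
    rw [InterlacedAt] at hk
    obtain h | rfl | h := lt_trichotomy j k
    · rw [Fin.lt_def] at h
      simp only [if_neg (show ¬ (k : ℕ) + 1 ≤ j + 1 by omega),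
        if_neg (show ¬ (k : ℕ) + 1 ≤ j by omega)]
      exact Even.add_self _
    · simp only [if_pos (le_refl ((j : ℕ) + 1)), if_neg (Nat.not_succ_le_self (j : ℕ))]
      rw [Int.even_iff]
      split_ifs <;> omega
    · rw [Fin.lt_def] at h
      simp only [if_pos (show (k : ℕ) + 1 ≤ j + 1 by omega),
        if_pos (show (k : ℕ) + 1 ≤ j by omega)]
      rw [Int.even_iff]
      split_ifs <;> omega
  · have h := top_ne_bot δ (Fin.last n) (Fin.last n)
    have hkn : (k : ℕ) + 1 ≤ n := k.2
    simp only [top_macroFlip, bot_macroFlip, Fin.val_last, if_pos hkn]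
    rw [Int.odd_iff]
    split_ifs <;> omega

/-! ### The sign-reversing involution -/

/-- The signed weight `(-1)^(n + des) q^(cmaj')` of a doubloon. -/
noncomputable def signedWeight (δ : Doubloon n) : ℤ[T;T⁻¹] :=
  (-1) ^ (n + wordDes (word δ)) * LaurentPolynomial.T δ.cmaj'

theorem signedWeight_of_interlaced (δ : Doubloon n) (h : Interlaced δ) (h0 : Normalized δ) :
    signedWeight δ = LaurentPolynomial.T δ.cmaj' := by
  have h1 : Even (n + wordDes (word δ)) := by
    exact_mod_cast even_wordDes_add_of_interlaced δ h h0
  rw [signedWeight, h1.neg_one_pow, one_mul]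

theorem signedWeight_add_macroFlip (δ : Doubloon n) (k : Fin n) (hk : ¬ InterlacedAt δ k) :
    signedWeight δ + signedWeight (macroFlip (k + 1) δ) = 0 := by
  have h1 : Odd (wordDes (word (macroFlip (k + 1) δ)) + wordDes (word δ)) := by
    exact_mod_cast odd_wordDes_add_macroFlip δ k hk
  rw [signedWeight, signedWeight, cmaj'_macroFlip δ k hk, ← add_mul, pow_add, pow_add, ← mul_add]
  obtain h | h := Nat.even_or_odd (wordDes (word δ))
  · rw [h.neg_one_pow, (Nat.odd_add.1 h1 |>.2 h).neg_one_pow]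
    simp
  · have h2 := Nat.odd_add'.1 h1 |>.1 h
    rw [h.neg_one_pow, h2.neg_one_pow]
    simp

/-- The least `k` for which the columns `k` and `k + 1` are not interlaced. -/
noncomputable def firstGap (δ : Doubloon n) : ℕ :=
  sInf {k | ∃ h : k < n, ¬ InterlacedAt δ ⟨k, h⟩}

theorem firstGap_macroFlip (k : ℕ) (δ : Doubloon n) :
    firstGap (macroFlip k δ) = firstGap δ := by
  simp only [firstGap, interlacedAt_macroFlip]

theorem exists_firstGap (δ : Doubloon n) (h : ¬ Interlaced δ) :
    ∃ k : Fin n, ¬ InterlacedAt δ k ∧ (k : ℕ) = firstGap δ := by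
  rw [interlaced_iff, not_forall] at h
  obtain ⟨k, hk⟩ := h
  obtain ⟨h1, h2⟩ := Nat.sInf_mem (s := {k | ∃ h : k < n, ¬ InterlacedAt δ ⟨k, h⟩}) ⟨k, k.2, hk⟩
  exact ⟨⟨_, h1⟩, h2, rfl⟩

theorem interlaced_macroFlip (k : ℕ) (δ : Doubloon n) :
    Interlaced (macroFlip k δ) ↔ Interlaced δ := by
  simp only [interlaced_iff, interlacedAt_macroFlip]

theorem normalized_macroFlip_succ (k : ℕ) (δ : Doubloon n) :
    Normalized (macroFlip (k + 1) δ) ↔ Normalized δ := by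
  simp [Normalized, top_macroFlip]

theorem sum_signedWeight_not_interlaced :
    ∑ δ : Doubloon n with δ.Normalized ∧ ¬ δ.Interlaced, signedWeight δ = 0 := by
  -- Flips preserve interlacing at every place, so the first gap is unchanged and the map is an
  -- involution. The shift by `1` spares column `0`, which keeps `a_0 = 0`.
  refine Finset.sum_involution (fun δ _ => macroFlip (firstGap δ + 1) δ) ?_ ?_ ?_ ?_
  · intro δ hδ
    obtain ⟨k, hk, hk'⟩ := exists_firstGap δ (Finset.mem_filter.1 hδ).2.2
    rw [← hk']
    exact signedWeight_add_macroFlip δ k hk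
  · intro δ hδ _ he
    obtain ⟨k, hk, hk'⟩ := exists_firstGap δ (Finset.mem_filter.1 hδ).2.2
    have h1 := top_macroFlip (firstGap δ + 1) δ (Fin.last n)
    have hkn : (k : ℕ) + 1 ≤ n := k.2
    rw [he, ← hk', Fin.val_last, if_pos hkn] at h1
    exact top_ne_bot _ _ _ h1
  · intro δ hδ
    rw [Finset.mem_filter] at hδ ⊢
    rw [normalized_macroFlip_succ, interlaced_macroFlip]
    exact ⟨Finset.mem_univ _, hδ.2⟩
  · intro δ _
    rw [firstGap_macroFlip, macroFlip_macroFlip]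

theorem sum_signedWeight_normalized :
    ∑ δ : Doubloon n with δ.Normalized, signedWeight δ =
      ∑ δ : Doubloon n with δ.Interlaced ∧ δ.Normalized,
        (LaurentPolynomial.T δ.cmaj' : ℤ[T;T⁻¹]) := by
  rw [← Finset.sum_filter_add_sum_filter_not _ (fun δ : Doubloon n => δ.Interlaced),
    Finset.filter_filter, Finset.filter_filter, sum_signedWeight_not_interlaced, add_zero]
  refine Finset.sum_congr (Finset.filter_congr fun _ _ => and_comm) fun δ hδ => ?_
  obtain ⟨_, h, h0⟩ := Finset.mem_filter.1 hδ
  exact signedWeight_of_interlaced δ h h0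

/-! ### Doubloons as permutations -/

/-- The position in the word `a_0 ⋯ a_n b_n ⋯ b_0` of each cell, counted from `0`. -/
def cellPosition (n : ℕ) (c : Fin 2 × Fin (n + 1)) : Fin (2 * n + 1 + 1) :=
  if c.1 = 0 then ⟨c.2, by omega⟩ else ⟨2 * n + 1 - c.2, by omega⟩

theorem cellPosition_bijective (n : ℕ) : Function.Bijective (cellPosition n) := by
  rw [Fintype.bijective_iff_injective_and_card]
  refine ⟨?_, by simp; ring⟩
  rintro ⟨r, k⟩ ⟨s, l⟩ h
  have hk := k.2
  have hl := l.2
  fin_cases r <;> fin_cases s <;> simp [cellPosition] at h ⊢ <;> omega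

/-- The word of a doubloon, as a permutation. -/
noncomputable def wordPerm (n : ℕ) : Doubloon n ≃ Equiv.Perm (Fin (2 * n + 1 + 1)) :=
  Equiv.equivCongr (Equiv.ofBijective _ (cellPosition_bijective n)) (Equiv.refl _)

theorem wordPerm_apply (δ : Doubloon n) (p : Fin (2 * n + 1 + 1)) :
    (wordPerm n δ p : ℕ) = (word δ).getD p 0 := by
  obtain ⟨⟨r, k⟩, rfl⟩ := (cellPosition_bijective n).2 p
  have h : wordPerm n δ (cellPosition n (r, k)) = δ (r, k) :=
    congrArg δ ((Equiv.ofBijective _ (cellPosition_bijective n)).symm_apply_apply (r, k))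
  rw [h]
  fin_cases r
  · exact (word_getD_top δ k).symm
  · exact (word_getD_bot δ k).symm

theorem wordPerm_zero_iff (δ : Doubloon n) : wordPerm n δ 0 = 0 ↔ Normalized δ := by
  rw [← Fin.val_inj, wordPerm_apply]
  exact Eq.congr_left (word_getD_top δ 0)

theorem prod_T {ι : Type*} (s : Finset ι) (f : ι → ℤ) :
    ∏ i ∈ s, (LaurentPolynomial.T (f i) : ℤ[T;T⁻¹]) = LaurentPolynomial.T (∑ i ∈ s, f i) := by
  classical
  induction s using Finset.induction_on with
  | empty => simp
  | insert a s ha ih => rw [Finset.prod_insert ha, Finset.sum_insert ha, ih, LaurentPolynomial.T_add]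

/-- Positions count from `0` in `descentWeight` and from `1` in `wordDescents`, hence `i - n`
against `i - (n + 1)`. The last factor removes the normalizing `(-1)^n q^(n²)` of the signed weight.
-/
theorem descentWeight_wordPerm (δ : Doubloon n) :
    descentWeight (fun i => -(LaurentPolynomial.T ((i : ℤ) - n) : ℤ[T;T⁻¹])) (wordPerm n δ) =
      signedWeight δ * (-LaurentPolynomial.T (-n : ℤ)) ^ n := by
  have h : descentWeight (fun i => -(LaurentPolynomial.T ((i : ℤ) - n) : ℤ[T;T⁻¹]))
      (wordPerm n δ) =
      ∏ i ∈ wordDescents (word δ), -(LaurentPolynomial.T ((i : ℤ) - (n + 1)) : ℤ[T;T⁻¹]) := by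
    rw [descentWeight, wordDescents, Finset.prod_filter, length_word,
      Finset.prod_Ico_eq_prod_range, show 2 * n + 2 - 1 = 2 * n + 1 by omega,
      ← Fin.prod_univ_eq_prod_range (fun i => if (word δ).getD (1 + i) 0 <
        (word δ).getD (1 + i - 1) 0 then
        -(LaurentPolynomial.T (((1 + i : ℕ) : ℤ) - (n + 1)) : ℤ[T;T⁻¹]) else 1)]
    refine Finset.prod_congr rfl fun i _ => ?_
    simp only [Fin.lt_def, wordPerm_apply, Fin.val_succ, Fin.val_castSucc, Nat.add_comm 1,
      Nat.add_sub_cancel]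
    congr 3
    push_cast
    ring
  have h2 : signedWeight δ = (-1) ^ (n + wordDes (word δ)) *
      LaurentPolynomial.T (∑ i ∈ wordDescents (word δ), ((i : ℤ) - (n + 1))) *
      LaurentPolynomial.T ((n : ℤ) ^ 2) := by
    rw [signedWeight, cmaj'_eq_sum_wordDescents, LaurentPolynomial.T_add, mul_assoc]
  have h3 : (-LaurentPolynomial.T (-n : ℤ) : ℤ[T;T⁻¹]) ^ n =
      (-1) ^ n * LaurentPolynomial.T (-(n : ℤ) ^ 2) := by
    rw [neg_pow, LaurentPolynomial.T_pow]
    congr 2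
    ring
  have h4 : (LaurentPolynomial.T ((n : ℤ) ^ 2) : ℤ[T;T⁻¹]) *
      LaurentPolynomial.T (-(n : ℤ) ^ 2) = 1 := by
    rw [← LaurentPolynomial.T_add, ← LaurentPolynomial.T_zero]
    congr 1
    ring
  have h5 : ((-1 : ℤ[T;T⁻¹]) ^ n * (-1 : ℤ[T;T⁻¹]) ^ n) = 1 := by
    rw [← mul_pow]; simp
  rw [h, Finset.prod_neg, prod_T, h2, h3, pow_add, wordDes]
  generalize (LaurentPolynomial.T (∑ i ∈ wordDescents (word δ), ((i : ℤ) - (n + 1))) :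
    ℤ[T;T⁻¹]) = W
  generalize (-1 : ℤ[T;T⁻¹]) ^ (wordDescents (word δ)).card = S
  linear_combination (-(S * W)) * h5 - S * W * ((-1 : ℤ[T;T⁻¹]) ^ n * (-1 : ℤ[T;T⁻¹]) ^ n) * h4

theorem descentSum_eq_sum_signedWeight (n : ℕ) :
    descentSum (fun i => -(LaurentPolynomial.T ((i : ℤ) - n) : ℤ[T;T⁻¹])) (2 * n + 1) =
      (∑ δ : Doubloon n with δ.Normalized, signedWeight δ) *
        (-LaurentPolynomial.T (-n : ℤ)) ^ n := by
  rw [descentSum, ← Equiv.sum_comp (wordPerm n), Finset.sum_mul, Finset.sum_filter]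
  refine Finset.sum_congr rfl fun δ _ => ?_
  simp only [wordPerm_zero_iff, descentWeight_wordPerm]

end Doubloon

theorem proposition12 (n : ℕ) :
    (∃ a : ℕ → ℤ[X], IsEulerianExpansion (2 * n + 1) a) ∧
      ∀ a : ℕ → ℤ[X], IsEulerianExpansion (2 * n + 1) a →
        Polynomial.toLaurent (a (n + 1)) =
          ∑ δ : Doubloon n with δ.Interlaced ∧ δ.Normalized,
            (LaurentPolynomial.T δ.cmaj' : ℤ[T;T⁻¹]) := by
  refine ⟨exists_isEulerianExpansion (2 * n), fun a ha => ?_⟩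
  have hu : IsUnit ((-LaurentPolynomial.T (-n : ℤ) : ℤ[T;T⁻¹]) ^ n) :=
    (LaurentPolynomial.isUnit_T (R := ℤ) _).neg.pow n
  apply hu.mul_right_cancel
  rw [← toLaurent_central n a ha, Doubloon.descentSum_eq_sum_signedWeight,
    Doubloon.sum_signedWeight_normalized]
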